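/- Let $K\subset\mathbb R^2$ be the solid regular triangle with vertices $a_1=(0,0)$, $a_2=(1,0)$, $a_3=(1/2,\sqrt3/2)$, and let $T_i(x)=(x+a_i)/2$ for $i=1,2,3$. For a finite word $\sigma=i_1\cdots i_k$ over $\{1,2,3\}$ put $T_\sigma=T_{i_1}\circ\cdots\circ T_{i_k}$ and $K_\sigma=T_\sigma(K)$ (so $K_\emptyset=K$), and let $\partial K_\sigma$ be the boundary of $K_\sigma$. For an integer $t\ge 0$ let $G_t$ be the graph whose vertex set $V_t$ consists of the words of length at most $t$, including the empty word, in which two distinct words $\sigma,\tau$ are joined by an edge if and only if $\partial K_\sigma\cap\partial K_\tau\neq\varnothing$. Then every $G_t$ is connected. Let $d_t$ be the geodesic (shortest path) distance of $G_t$, and let $$\bar D(t)=\frac{\sum_{\{\sigma,\tau\}}d_t(\sigma,\tau)}{\#V_t(\#V_t-1)/2},$$ where the sum runs over all unordered pairs of distinct vertices of $G_t$, be its average path length (for $t\ge1$). Then $$\lim_{t\to\infty}\frac{\bar D(t)}{t}=\frac49 .$$ Consequently $\bar D(t)$ is asymptotically proportional to $\ln(\#V_t)$: $$\lim_{t\to\infty}\frac{\bar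 D(t)}{\ln(\#V_t)}=\frac{4}{9\ln 3}.$$ -/

import Mathlib

namespace SierpinskiNetwork

noncomputable section

/-- The Euclidean plane. -/
abbrev Plane : Type := EuclideanSpace ℝ (Fin 2)

/-- The three vertices `(0,0)`, `(1,0)`, `(1/2, √3/2)` of the unit regular triangle.
The letters `1, 2, 3` are represented by `0, 1, 2 : Fin 3`. -/
def corner : Fin 3 → Plane :=
  ![!₂[0, 0], !₂[1, 0], !₂[1 / 2, Real.sqrt 3 / 2]]

/-- The solid regular triangle `K`. -/
def triangle : Set Plane := convexHull ℝ (Set.range corner)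

/-- The contracting similitude `T_i(x) = x/2 + a_i/2`. -/
def contraction (i : Fin 3) (x : Plane) : Plane :=
  (1 / 2 : ℝ) • x + (1 / 2 : ℝ) • corner i

/-- Words over the three letters. -/
abbrev Word : Type := List (Fin 3)

/-- `T_σ = T_{i₁} ∘ ⋯ ∘ T_{i_k}` for the word `σ = i₁ ⋯ i_k`; it is the identity for the
empty word. -/
def wordMap : Word → Plane → Plane
  | [] => id
  | i :: σ => contraction i ∘ wordMap σ

/-- The solid triangle `K_σ = T_σ(K)`. -/
def cell (σ : Word) : Set Plane := wordMap σ '' triangle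

/-- The boundary of the solid triangle `K_σ`. -/
def cellBoundary (σ : Word) : Set Plane := frontier (cell σ)

/-- The vertex set `V_t`: the words of length at most `t`. -/
abbrev Vertex (t : ℕ) : Type := {σ : Word // σ.length ≤ t}

instance vertexFintype (t : ℕ) : Fintype (Vertex t) :=
  (List.finite_length_le (Fin 3) t).fintype

/-- The network `G_t`: two distinct words are joined when the boundaries of their triangles
intersect. -/
def network (t : ℕ) : SimpleGraph (Vertex t) where
  Adj σ τ := σ ≠ τ ∧ (cellBoundary σ.1 ∩ cellBoundary τ.1).Nonempty
  symm := ⟨fun _ _ h => ⟨h.1.symm, by rw [Set.inter_comm]; exact h.2⟩⟩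
  loopless := ⟨fun _ h => h.1 rfl⟩

/-- The geodesic distance of the two words in an unordered pair of vertices of `G_t`. -/
def pairDist (t : ℕ) : Sym2 (Vertex t) → ℕ :=
  Sym2.lift ⟨fun σ τ => (network t).dist σ τ, fun _ _ => SimpleGraph.dist_comm⟩

/-- The average path length `D̄(t)` of `G_t`: the sum of the geodesic distances over all
unordered pairs of distinct vertices, divided by the number `#V_t (#V_t - 1) / 2` of pairs. -/
def averagePathLength (t : ℕ) : ℝ :=
  (∑ e : Sym2 (Vertex t) with ¬ e.IsDiag, (pairDist t e : ℝ)) /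
    ((Fintype.card (Vertex t) : ℝ) * ((Fintype.card (Vertex t) : ℝ) - 1) / 2)

end

end SierpinskiNetwork

namespace SierpinskiNetwork

open SimpleGraph Finset Filter Topology

/-! ### Barycentric coordinates -/

/-! In barycentric coordinates the boundary of the triangle is where a coordinate vanishes, and a
letter `k` in a word pushes coordinate `k` above zero. Hence adjacent words have the form `ω ++ σ`,
`ω ++ τ` with `σ` and `τ` missing a common letter, and a word is adjacent to each proper extension
by a suffix missing a letter.

Let `blocks univ σ` be the number of blocks in the greedy cutting of `σ` into pieces that each miss
a letter; starting from `univ` makes the first letter open a block. Deleting blocks gives a path to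
the root, and an edge changes the count by at most one. Going through the root bounds the distance
of `u` and `v` by the sum of their counts. Conversely a path must leave the cells below their common
prefix, so at most twice the common prefix length plus a constant is saved, which is bounded on
average.

A greedy block has mean length 3/2 + 3 = 9/2 (waiting times for a second and a third letter), so a
typical word has about 2t/9 blocks, and a pair is at distance about 4t/9. -/

theorem affineIndependent_corner : AffineIndependent ℝ corner := by
  rw [affineIndependent_iff_of_fintype]
  intro w hw h
  rw [univ.weightedVSub_eq_linear_combination hw] at h
  have h0 := congrArg (fun x : Plane => x 0) h
  have h1 := congrArg (fun x : Plane => x 1) h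
  simp [Fin.sum_univ_three, corner] at h0 h1 hw
  intro i
  fin_cases i <;> simp <;> linarith

/-- The corners of the triangle as an affine basis of the plane. -/
noncomputable def cornerBasis : AffineBasis (Fin 3) ℝ Plane :=
  ⟨corner, affineIndependent_corner, by
    rw [affineIndependent_corner.affineSpan_eq_top_iff_card_eq_finrank_add_one]
    simp⟩

theorem coord_corner (i k : Fin 3) : cornerBasis.coord k (corner i) = if k = i then 1 else 0 :=
  cornerBasis.coord_apply k i

theorem contraction_eq_lineMap (i : Fin 3) (x : Plane) :
    contraction i x = AffineMap.lineMap (corner i) x (1 / 2 : ℝ) := by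
  rw [AffineMap.lineMap_apply_module, contraction, add_comm]
  norm_num

theorem coord_contraction (i k : Fin 3) (x : Plane) :
    cornerBasis.coord k (contraction i x) =
      cornerBasis.coord k x / 2 + if k = i then 1 / 2 else 0 := by
  rw [contraction_eq_lineMap, AffineMap.apply_lineMap, AffineMap.lineMap_apply_module,
    coord_corner]
  split_ifs <;> norm_num <;> ring

theorem mem_triangle_iff (x : Plane) : x ∈ triangle ↔ ∀ k, 0 ≤ cornerBasis.coord k x := by
  have h := cornerBasis.convexHull_eq_nonneg_coord
  change triangle = _ at h
  rw [h]; rfl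

theorem mem_frontier_triangle_iff (x : Plane) :
    x ∈ frontier triangle ↔ x ∈ triangle ∧ ∃ k, cornerBasis.coord k x = 0 := by
  have hc : IsClosed triangle := (Set.finite_range corner).isClosed_convexHull ℝ
  have h := cornerBasis.interior_convexHull
  change interior triangle = _ at h
  rw [hc.frontier_eq, h, Set.mem_sdiff]
  refine and_congr_right fun hx => ?_
  rw [mem_triangle_iff] at hx
  simp only [Set.mem_ofPred_eq, not_forall, not_lt]
  exact exists_congr fun k => ⟨fun h => le_antisymm h (hx k), fun h => h.le⟩

theorem exists_homeomorph_contraction (i : Fin 3) : ∃ h : Plane ≃ₜ Plane, ⇑h = contraction i :=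
  ⟨(Homeomorph.smulOfNeZero (1 / 2 : ℝ) (by norm_num)).trans
    (Homeomorph.addRight ((1 / 2 : ℝ) • corner i)), rfl⟩

theorem exists_homeomorph_wordMap (σ : Word) : ∃ h : Plane ≃ₜ Plane, ⇑h = wordMap σ := by
  induction σ with
  | nil => exact ⟨Homeomorph.refl _, rfl⟩
  | cons i σ ih =>
    obtain ⟨h, hh⟩ := ih
    obtain ⟨g, hg⟩ := exists_homeomorph_contraction i
    exact ⟨h.trans g, by rw [wordMap, ← hh, ← hg]; rfl⟩

theorem contraction_injective (i : Fin 3) : Function.Injective (contraction i) := by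
  obtain ⟨h, hh⟩ := exists_homeomorph_contraction i
  rw [← hh]; exact h.injective

theorem cellBoundary_eq (σ : Word) : cellBoundary σ = wordMap σ '' frontier triangle := by
  obtain ⟨h, hh⟩ := exists_homeomorph_wordMap σ
  rw [cellBoundary, cell, ← hh, h.image_frontier]

theorem wordMap_append (σ τ : Word) (x : Plane) :
    wordMap (σ ++ τ) x = wordMap σ (wordMap τ x) := by
  induction σ with
  | nil => rfl
  | cons i σ ih => simp [wordMap, ih]

theorem contraction_mem_triangle (i : Fin 3) {x : Plane} (hx : x ∈ triangle) :
    contraction i x ∈ triangle := by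
  rw [mem_triangle_iff] at hx ⊢
  intro k
  rw [coord_contraction]
  have := hx k
  split_ifs <;> linarith

theorem wordMap_mem_triangle (σ : Word) {x : Plane} (hx : x ∈ triangle) :
    wordMap σ x ∈ triangle := by
  induction σ with
  | nil => exact hx
  | cons i σ ih => exact contraction_mem_triangle i ih

theorem coord_wordMap_eq_zero {σ : Word} {k : Fin 3} (hk : k ∉ σ) {x : Plane}
    (hx : cornerBasis.coord k x = 0) : cornerBasis.coord k (wordMap σ x) = 0 := by
  induction σ with
  | nil => exact hx
  | cons i σ ih =>
    simp only [List.mem_cons, not_or] at hk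
    rw [wordMap, Function.comp_apply, coord_contraction, ih hk.2, if_neg hk.1]
    norm_num

/-- Each letter halves coordinate `k`, which is nonnegative, and the letter `k` also adds 1/2, so a
zero excludes `k`. -/
theorem notMem_of_coord_wordMap_eq_zero {σ : Word} {k : Fin 3} {x : Plane} (hx : x ∈ triangle)
    (h : cornerBasis.coord k (wordMap σ x) = 0) : k ∉ σ := by
  induction σ with
  | nil => simp
  | cons i σ ih =>
    rw [wordMap, Function.comp_apply, coord_contraction] at h
    have h0 := (mem_triangle_iff _).1 (wordMap_mem_triangle σ hx) k
    split_ifs at h with hki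
    · linarith
    · simp only [List.mem_cons, not_or]
      exact ⟨hki, ih (by linarith)⟩

/-! ### Combinatorial description of the edges -/

theorem cellBoundary_append_inter_nonempty (ω : Word) {σ : Word} {k : Fin 3} (hk : k ∉ σ) :
    (cellBoundary (ω ++ σ) ∩ cellBoundary ω).Nonempty := by
  -- Any corner other than `k` lies on the side opposite `k`, and maps with letters different from
  -- `k` keep it on that side.
  have hc : cornerBasis.coord k (corner (k + 1)) = 0 := by
    rw [coord_corner, if_neg (by simp)]
  have hT : corner (k + 1) ∈ triangle := subset_convexHull ℝ _ ⟨_, rfl⟩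
  rw [cellBoundary_eq, cellBoundary_eq]
  refine ⟨wordMap (ω ++ σ) (corner (k + 1)),
    ⟨_, (mem_frontier_triangle_iff _).2 ⟨hT, k, hc⟩, rfl⟩,
    ⟨wordMap σ (corner (k + 1)), (mem_frontier_triangle_iff _).2
      ⟨wordMap_mem_triangle σ hT, k, coord_wordMap_eq_zero hk hc⟩, (wordMap_append _ _ _).symm⟩⟩

theorem exists_common_missing_letter {σ τ : Word} {x y : Plane} (hx : x ∈ frontier triangle)
    (hy : y ∈ frontier triangle) (h : wordMap σ x = wordMap τ y) :
    ∃ (ω σ' τ' : Word) (k : Fin 3), σ = ω ++ σ' ∧ τ = ω ++ τ' ∧ k ∉ σ' ∧ k ∉ τ' := by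
  rw [mem_frontier_triangle_iff] at hx hy
  induction σ generalizing τ with
  | nil =>
    obtain ⟨k, hk⟩ := hx.2
    change x = _ at h
    exact ⟨[], [], τ, k, rfl, rfl, by simp,
      notMem_of_coord_wordMap_eq_zero hy.1 (by rw [← h, hk])⟩
  | cons i σ ih =>
    cases τ with
    | nil =>
      obtain ⟨k, hk⟩ := hy.2
      change _ = y at h
      exact ⟨[], i :: σ, [], k, rfl, rfl,
        notMem_of_coord_wordMap_eq_zero hx.1 (by rw [h, hk]), by simp⟩
    | cons j τ =>
      by_cases hij : i = j
      · subst hij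
        obtain ⟨ω, σ', τ', k, h1, h2, h3, h4⟩ := ih (contraction_injective i h)
        exact ⟨i :: ω, σ', τ', k, by simp [h1], by simp [h2], h3, h4⟩
      -- With different first letters, two coordinates of the common point are at least 1/2; since
      -- the sum is 1, the third vanishes.
      · have hi : 1 / 2 ≤ cornerBasis.coord i (wordMap (i :: σ) x) := by
          rw [wordMap, Function.comp_apply, coord_contraction, if_pos rfl]
          linarith [(mem_triangle_iff _).1 (wordMap_mem_triangle σ hx.1) i]
        have hj : 1 / 2 ≤ cornerBasis.coord j (wordMap (i :: σ) x) := by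
          rw [h, wordMap, Function.comp_apply, coord_contraction, if_pos rfl]
          linarith [(mem_triangle_iff _).1 (wordMap_mem_triangle τ hy.1) j]
        obtain ⟨k, hki, hkj⟩ : ∃ k, k ≠ i ∧ k ≠ j := by
          clear * -
          decide +revert
        have hk : cornerBasis.coord k (wordMap (i :: σ) x) = 0 := by
          have h0 := (mem_triangle_iff _).1 (wordMap_mem_triangle (i :: σ) hx.1) k
          have hs := cornerBasis.sum_coord_apply_eq_one (wordMap (i :: σ) x)
          have hu : (univ : Finset (Fin 3)) = {k, i, j} := by
            clear * - hij hki hkj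
            decide +revert
          rw [hu, sum_insert (by simp [hki, hkj]), sum_insert (by simp [hij]),
            sum_singleton] at hs
          linarith
        exact ⟨[], i :: σ, j :: τ, k, rfl, rfl, notMem_of_coord_wordMap_eq_zero hx.1 hk,
          notMem_of_coord_wordMap_eq_zero hy.1 (by rw [← h, hk])⟩

theorem exists_of_adj {t : ℕ} {u v : Vertex t} (h : (network t).Adj u v) :
    ∃ (ω σ τ : Word) (k : Fin 3), u.1 = ω ++ σ ∧ v.1 = ω ++ τ ∧ k ∉ σ ∧ k ∉ τ := by
  obtain ⟨-, p, hp, hp'⟩ := h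
  rw [cellBoundary_eq] at hp hp'
  obtain ⟨x, hx, rfl⟩ := hp
  obtain ⟨y, hy, hxy⟩ := hp'
  exact exists_common_missing_letter hx hy hxy.symm

theorem dist_append_le_one {t : ℕ} {u v : Vertex t} {σ : Word} {k : Fin 3} (hk : k ∉ σ)
    (h : u.1 = v.1 ++ σ) : (network t).Reachable u v ∧ (network t).dist u v ≤ 1 := by
  by_cases huv : u = v
  · subst huv; simp
  · have hadj : (network t).Adj u v := ⟨huv, by
      rw [h]; exact cellBoundary_append_inter_nonempty _ hk⟩
    exact ⟨hadj.reachable, (dist_eq_one_iff_adj.2 hadj).le⟩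

/-! ### The greedy number of blocks -/

/-- The number of new blocks opened when `σ` is cut greedily, from left to right, into blocks
each missing a letter, the letters of the current block being `S` at the start. -/
def blocks : Finset (Fin 3) → Word → ℕ
  | _, [] => 0
  | S, i :: σ => if insert i S = univ then blocks {i} σ + 1 else blocks (insert i S) σ

@[simp]
theorem blocks_nil (S : Finset (Fin 3)) : blocks S [] = 0 := rfl

/-- The letters of the last block after cutting `σ` greedily. -/
def lastBlock : Finset (Fin 3) → Word → Finset (Fin 3)
  | S, [] => S
  | S, i :: σ => if insert i S = univ then lastBlock {i} σ else lastBlock (insert i S) σ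

theorem blocks_append (S : Finset (Fin 3)) (σ τ : Word) :
    blocks S (σ ++ τ) = blocks S σ + blocks (lastBlock S σ) τ := by
  induction σ generalizing S with
  | nil => simp [blocks, lastBlock]
  | cons i σ ih =>
    simp only [List.cons_append, blocks, lastBlock]
    split_ifs <;> rw [ih]
    omega

theorem blocks_eq_zero {S : Finset (Fin 3)} {σ : Word} {k : Fin 3} (hS : k ∉ S) (hσ : k ∉ σ) :
    blocks S σ = 0 := by
  induction σ generalizing S with
  | nil => rfl
  | cons i σ ih =>
    simp only [List.mem_cons, not_or] at hσ
    have hk : k ∉ insert i S := by simp [hσ.1, hS]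
    have hne : insert i S ≠ univ := fun h => hk (h.symm ▸ mem_univ k)
    rw [blocks, if_neg hne, ih hk hσ.2]

/-- Once a new block is opened inside `σ`, it never meets `k` and so never fills up. -/
theorem blocks_le_one (S : Finset (Fin 3)) {σ : Word} {k : Fin 3} (hσ : k ∉ σ) :
    blocks S σ ≤ 1 := by
  induction σ generalizing S with
  | nil => simp [blocks]
  | cons i σ ih =>
    simp only [List.mem_cons, not_or] at hσ
    rw [blocks]
    split_ifs
    · rw [blocks_eq_zero (by simpa using hσ.1) hσ.2]
    · exact ih _ hσ.2

theorem blocks_le_length (S : Finset (Fin 3)) (σ : Word) : blocks S σ ≤ σ.length := by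
  induction σ generalizing S with
  | nil => simp [blocks]
  | cons i σ ih =>
    rw [blocks, List.length_cons]
    split_ifs
    · exact Nat.succ_le_succ (ih _)
    · exact (ih _).trans (Nat.le_succ _)

theorem blocks_append_le {ω σ : Word} {k : Fin 3} (hk : k ∉ σ) :
    blocks univ (ω ++ σ) ≤ blocks univ ω + 1 := by
  rw [blocks_append]
  exact Nat.add_le_add_left (blocks_le_one _ hk) _

theorem blocks_le_of_adj {t : ℕ} {u v : Vertex t} (h : (network t).Adj u v) :
    blocks univ u.1 ≤ blocks univ v.1 + 1 := by
  obtain ⟨ω, σ, τ, k, hu, hv, hσ, -⟩ := exists_of_adj h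
  rw [hu, hv]
  refine (blocks_append_le hσ).trans ?_
  rw [blocks_append]
  omega

/-! ### Distances -/

theorem blocks_le_of_walk {t : ℕ} {u v : Vertex t} (p : (network t).Walk u v) :
    blocks univ u.1 ≤ blocks univ v.1 + p.length := by
  induction p with
  | nil => simp
  | cons h p ih =>
    have := blocks_le_of_adj h
    rw [Walk.length_cons]
    omega

/-- A walk leaving the cell of `ρ` passes a word close to `ρ`. -/
theorem blocks_add_blocks_le_of_walk {t : ℕ} {ρ : Word} {u v : Vertex t}
    (p : (network t).Walk u v) (hu : ρ <+: u.1) (hv : ¬ ρ <+: v.1) :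
    blocks univ u.1 + blocks univ v.1 ≤ p.length + 2 * (blocks univ ρ + 1) := by
  induction p with
  | nil => exact absurd hu hv
  | @cons u w v h p ih =>
    rw [Walk.length_cons]
    by_cases hw : ρ <+: w.1
    · have := ih hw hv
      have := blocks_le_of_adj h
      omega
    · have hvw := blocks_le_of_walk p.reverse
      rw [Walk.length_reverse] at hvw
      have hwu := blocks_le_of_adj h.symm
      -- This edge leaves the cell of `ρ`, so its common prefix `ω` is a prefix of `ρ`; what follows
      -- `ρ` in `u` is a tail of `σ` and misses `k`.
      have hρ : blocks univ u.1 ≤ blocks univ ρ + 1 := by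
        obtain ⟨ω, σ, τ, k, h1, h2, h3, -⟩ := exists_of_adj h
        have hωu : ω <+: u.1 := ⟨σ, h1.symm⟩
        have hωw : ω <+: w.1 := ⟨τ, h2.symm⟩
        rcases List.prefix_or_prefix_of_prefix hu hωu with h' | h'
        · exact absurd (h'.trans hωw) hw
        · obtain ⟨s, rfl⟩ := h'
          obtain ⟨r, hr⟩ := hu
          rw [← hr]
          refine blocks_append_le (k := k) fun hkr => h3 ?_
          rw [h1, List.append_assoc] at hr
          rw [← List.append_cancel_left hr]
          exact List.mem_append_right _ hkr
      omega

/-- The empty word as a vertex. -/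
def root (t : ℕ) : Vertex t := ⟨[], Nat.zero_le t⟩

/-- Here `σ₁` finishes the current block. Restarting `σ₂` from `univ` counts its first letter as an
opening, just as the greedy cutting does. -/
theorem exists_missing_block (S : Finset (Fin 3)) (hS : S ≠ univ) (σ : Word) :
    ∃ σ₁ σ₂ : Word, σ = σ₁ ++ σ₂ ∧ (∃ k, k ∉ S ∧ k ∉ σ₁) ∧
      blocks S σ = blocks univ σ₂ := by
  induction σ generalizing S with
  | nil =>
    obtain ⟨k, hk⟩ : ∃ k, k ∉ S := by
      by_contra! h; exact hS (eq_univ_iff_forall.2 h)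
    exact ⟨[], [], rfl, ⟨k, hk, by simp⟩, rfl⟩
  | cons i σ ih =>
    by_cases hi : insert i S = univ
    · obtain ⟨k, hk⟩ : ∃ k, k ∉ S := by
        by_contra! h; exact hS (eq_univ_iff_forall.2 h)
      exact ⟨[], i :: σ, rfl, ⟨k, hk, by simp⟩, by simp [blocks, hi]⟩
    · obtain ⟨σ₁, σ₂, h1, ⟨k, hk, hk'⟩, h2⟩ := ih _ hi
      rw [mem_insert, not_or] at hk
      exact ⟨i :: σ₁, σ₂, by simp [h1], ⟨k, hk.2, by simp [hk.1, hk']⟩, by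
        rw [blocks, if_neg hi, h2]⟩

theorem exists_walk_append (t : ℕ) (n : ℕ) (ω σ : Word) (hn : blocks univ σ = n)
    (hω : (ω ++ σ).length ≤ t) (hω' : ω.length ≤ t) :
    (network t).Reachable ⟨ω ++ σ, hω⟩ ⟨ω, hω'⟩ ∧
      (network t).dist ⟨ω ++ σ, hω⟩ ⟨ω, hω'⟩ ≤ n := by
  induction n generalizing ω σ with
  | zero =>
    cases σ with
    | nil => simp
    | cons i σ => simp [blocks] at hn
  | succ n ih =>
    cases σ with
    | nil => simp [blocks] at hn
    | cons i σ =>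
      rw [blocks, if_pos (by simp)] at hn
      obtain ⟨σ₁, σ₂, rfl, ⟨k, hk, hk'⟩, h2⟩ := exists_missing_block {i}
        (by clear * -; decide +revert) σ
      have hlen : (ω ++ i :: σ₁).length ≤ t := by
        simp only [List.length_append, List.length_cons] at hω ⊢; omega
      have key := ih (ω ++ i :: σ₁) σ₂ (by omega) (by simpa using hω) hlen
      have key' := dist_append_le_one (t := t) (u := ⟨ω ++ i :: σ₁, hlen⟩) (v := ⟨ω, hω'⟩)
        (σ := i :: σ₁) (k := k) (by simpa [hk'] using hk) rfl
      simp only [List.append_assoc, List.cons_append] at key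
      refine ⟨key.1.trans key'.1, ?_⟩
      obtain ⟨p, hp⟩ := key.1.exists_walk_length_eq_dist
      obtain ⟨q, hq⟩ := key'.1.exists_walk_length_eq_dist
      refine (dist_le (p.append q)).trans ?_
      rw [Walk.length_append]
      omega

theorem reachable_root {t : ℕ} (u : Vertex t) :
    (network t).Reachable u (root t) ∧ (network t).dist u (root t) ≤ blocks univ u.1 :=
  exists_walk_append t _ [] u.1 rfl u.2 (Nat.zero_le t)

theorem network_connected (t : ℕ) : (network t).Connected :=
  (connected_iff_exists_forall_reachable _).2 ⟨root t, fun u => (reachable_root u).1.symm⟩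

theorem dist_le_blocks_add_blocks {t : ℕ} (u v : Vertex t) :
    (network t).dist u v ≤ blocks univ u.1 + blocks univ v.1 := by
  refine (network_connected t).dist_triangle (v := root t) |>.trans ?_
  have h1 := (reachable_root u).2
  have h2 := (reachable_root v).2
  rw [dist_comm] at h2
  omega

/-- The length of the longest common prefix. -/
def commonLength : Word → Word → ℕ
  | i :: σ, j :: τ => if i = j then commonLength σ τ + 1 else 0
  | _, _ => 0

theorem prefix_or_exists_prefix (σ τ : Word) :
    (σ <+: τ ∧ σ.length = commonLength σ τ) ∨
      ∃ ρ, ρ <+: σ ∧ ¬ ρ <+: τ ∧ ρ.length = commonLength σ τ + 1 := by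
  induction σ generalizing τ with
  | nil => left; simp [commonLength]
  | cons i σ ih =>
    cases τ with
    | nil => right; exact ⟨[i], by simp, by simp, by simp [commonLength]⟩
    | cons j τ =>
      by_cases hij : i = j
      · subst hij
        rcases ih τ with h | ⟨ρ, h1, h2, h3⟩
        · left; simpa [commonLength] using h
        · right; exact ⟨i :: ρ, by simpa using h1, by simpa using h2, by simp [commonLength, h3]⟩
      · right; exact ⟨[i], by simp, by simpa using hij, by simp [commonLength, hij]⟩

/-- If `u` is not a prefix of `v`, its prefix `ρ` one letter longer than the common one must be
left, and `ρ` has at most `commonLength + 1` blocks. Otherwise `u` itself has at most `commonLength`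
blocks. -/
theorem blocks_add_blocks_le_dist {t : ℕ} (u v : Vertex t) :
    blocks univ u.1 + blocks univ v.1 ≤
      (network t).dist u v + 2 * (commonLength u.1 v.1 + 2) := by
  obtain ⟨p, hp⟩ := (network_connected t).exists_walk_length_eq_dist u v
  rcases prefix_or_exists_prefix u.1 v.1 with ⟨-, h⟩ | ⟨ρ, h1, h2, h3⟩
  · have hv := blocks_le_of_walk p.reverse
    have := blocks_le_length univ u.1
    rw [Walk.length_reverse] at hv
    omega
  · have := blocks_add_blocks_le_of_walk p h1 h2
    have := blocks_le_length univ ρ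
    omega

/-! ### Sums over all words of bounded length -/

theorem sum_vertex_zero {M : Type*} [AddCommMonoid M] (F : Word → M) :
    ∑ v : Vertex 0, F v.1 = F [] := by
  rw [Fintype.sum_eq_single (root 0)]
  · rfl
  · rintro ⟨σ, hσ⟩ h
    exact absurd (Subtype.ext (List.eq_nil_of_length_eq_zero (Nat.le_zero.1 hσ))) h

/-- A nonempty word is its first letter followed by a shorter word. -/
def vertexSuccEquiv (t : ℕ) : Option (Fin 3 × Vertex t) ≃ Vertex (t + 1) where
  toFun
    | none => root (t + 1)
    | some (i, v) => ⟨i :: v.1, Nat.succ_le_succ v.2⟩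
  invFun
    | ⟨[], _⟩ => none
    | ⟨i :: σ, h⟩ => some (i, ⟨σ, Nat.le_of_succ_le_succ h⟩)
  left_inv := by rintro (_ | ⟨i, v⟩) <;> rfl
  right_inv := by rintro ⟨_ | ⟨i, σ⟩, h⟩ <;> rfl

theorem sum_vertex_succ {M : Type*} [AddCommMonoid M] (t : ℕ) (F : Word → M) :
    ∑ v : Vertex (t + 1), F v.1 = F [] + ∑ i, ∑ v : Vertex t, F (i :: v.1) := by
  rw [← (vertexSuccEquiv t).sum_comp, Fintype.sum_option, Fintype.sum_prod_type]
  rfl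

theorem card_vertex (t : ℕ) : (Fintype.card (Vertex t) : ℝ) = (3 ^ (t + 1) - 1) / 2 := by
  have hcard (t : ℕ) : (Fintype.card (Vertex t) : ℝ) = ∑ _v : Vertex t, (1 : ℝ) := by simp
  induction t with
  | zero => rw [hcard, sum_vertex_zero fun _ => (1 : ℝ)]; norm_num
  | succ t ih =>
    rw [hcard, sum_vertex_succ t fun _ => (1 : ℝ), ← hcard, ih]
    simp only [sum_const, card_univ, Fintype.card_fin, nsmul_eq_mul]
    push_cast
    ring

/-- A two-state recursion on the size of the current block: from size 1, one letter stays and two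
lead to size 2; from size 2, two letters stay and one opens a new block of size 1. The closed forms
solve it. -/
theorem sum_blocks_of_ne_univ (t : ℕ) :
    (∀ i, ∑ v : Vertex t, (blocks {i} v.1 : ℝ) = (2 * t * 3 ^ t + 3 - 3 * 3 ^ t) / 6) ∧
    ∀ i j, i ≠ j → ∑ v : Vertex t, (blocks {i, j} v.1 : ℝ) = (2 * t * 3 ^ t) / 6 := by
  induction t with
  | zero =>
    refine ⟨fun i => ?_, fun i j _ => ?_⟩
    · rw [sum_vertex_zero fun σ => (blocks {i} σ : ℝ)]; norm_num [blocks]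
    · rw [sum_vertex_zero fun σ => (blocks {i, j} σ : ℝ)]; norm_num [blocks]
  | succ t ih =>
    have hadd (i : Fin 3) : ∑ v : Vertex t, ((blocks {i} v.1 + 1 : ℕ) : ℝ) =
        (2 * t * 3 ^ t + 3 - 3 * 3 ^ t) / 6 + (3 ^ (t + 1) - 1) / 2 := by
      push_cast
      rw [sum_add_distrib, ih.1, ← card_vertex]
      simp
    refine ⟨fun i => ?_, fun i j hij => ?_⟩
    · rw [sum_vertex_succ t fun σ => (blocks {i} σ : ℝ)]
      have h (j : Fin 3) : ∑ v : Vertex t, (blocks {i} (j :: v.1) : ℝ) =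
          (if j = i then (2 * t * 3 ^ t + 3 - 3 * 3 ^ t) / 6 else (2 * t * 3 ^ t) / 6 : ℝ) := by
        have hne : insert j ({i} : Finset (Fin 3)) ≠ univ := by
          clear * -
          decide +revert
        simp only [blocks, if_neg hne]
        split_ifs with hj
        · subst hj
          simpa using ih.1 j
        · exact ih.2 j i hj
      simp only [h, blocks_nil, sum_ite, sum_const, nsmul_eq_mul]
      have h1 : #{x : Fin 3 | x = i} = 1 := by clear * -; decide +revert
      have h2 : #{x : Fin 3 | ¬ x = i} = 2 := by clear * -; decide +revert
      rw [h1, h2]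
      push_cast
      ring
    · rw [sum_vertex_succ t fun σ => (blocks {i, j} σ : ℝ)]
      have h (k : Fin 3) : ∑ v : Vertex t, (blocks {i, j} (k :: v.1) : ℝ) =
          (if k = i ∨ k = j then (2 * t * 3 ^ t) / 6 else
            (2 * t * 3 ^ t + 3 - 3 * 3 ^ t) / 6 + (3 ^ (t + 1) - 1) / 2 : ℝ) := by
        split_ifs with hk
        · have hS : insert k ({i, j} : Finset (Fin 3)) = {i, j} := by
            clear * - hk
            decide +revert
          have hne : ({i, j} : Finset (Fin 3)) ≠ univ := by
            clear * -
            decide +revert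
          simp only [blocks, hS, if_neg hne]
          exact ih.2 i j hij
        · have hS : insert k ({i, j} : Finset (Fin 3)) = univ := by
            clear * - hk hij
            decide +revert
          simp only [blocks, if_pos hS]
          exact hadd k
      simp only [h, blocks_nil, sum_ite, sum_const, nsmul_eq_mul]
      have h1 : #{x : Fin 3 | x = i ∨ x = j} = 2 := by clear * - hij; decide +revert
      have h2 : #{x : Fin 3 | ¬ (x = i ∨ x = j)} = 1 := by clear * - hij; decide +revert
      rw [h1, h2]
      push_cast
      ring

theorem sum_blocks_univ (t : ℕ) :
    ∑ v : Vertex (t + 1), (blocks univ v.1 : ℝ) = (t + 3) * 3 ^ t := by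
  rw [sum_vertex_succ t fun σ => (blocks univ σ : ℝ)]
  have h (i : Fin 3) : ∑ v : Vertex t, (blocks univ (i :: v.1) : ℝ) =
      (2 * t * 3 ^ t + 3 - 3 * 3 ^ t) / 6 + (3 ^ (t + 1) - 1) / 2 := by
    have hS : insert i (univ : Finset (Fin 3)) = univ := by simp
    simp only [blocks, if_pos hS]
    push_cast
    rw [sum_add_distrib, (sum_blocks_of_ne_univ t).1, ← card_vertex]
    simp
  simp only [h, blocks_nil, sum_const, nsmul_eq_mul, card_univ, Fintype.card_fin]
  push_cast
  ring

/-- With `N` vertices and sum `S` at level `t`, the next sum is `3 * S + 3 * N ^ 2`, at most `6 * N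
^ 2`, while the next count is `1 + 3 * N`. -/
theorem sum_commonLength_le (t : ℕ) :
    ∑ u : Vertex t, ∑ v : Vertex t, commonLength u.1 v.1 ≤ Fintype.card (Vertex t) ^ 2 := by
  induction t with
  | zero =>
    rw [sum_vertex_zero fun σ => ∑ v : Vertex 0, commonLength σ v.1]
    simp [commonLength]
  | succ t ih =>
    have hcard : Fintype.card (Vertex (t + 1)) = 1 + 3 * Fintype.card (Vertex t) := by
      have h := sum_vertex_succ t fun _ => 1
      simp only [sum_const, card_univ, Fintype.card_fin, smul_eq_mul, mul_one] at h
      exact h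
    rw [sum_vertex_succ t fun σ => ∑ v : Vertex (t + 1), commonLength σ v.1]
    have h (i : Fin 3) (u : Vertex t) : ∑ v : Vertex (t + 1), commonLength (i :: u.1) v.1 =
        ∑ v : Vertex t, commonLength u.1 v.1 + Fintype.card (Vertex t) := by
      rw [sum_vertex_succ t fun σ => commonLength (i :: u.1) σ, Fintype.sum_eq_single i]
      · simp [commonLength, sum_add_distrib]
      · intro j hj
        simp [commonLength, hj.symm]
    simp only [h, sum_add_distrib, sum_const, card_univ, Fintype.card_fin, smul_eq_mul,
      commonLength, hcard]
    nlinarith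

/-! ### The average path length -/

theorem averagePathLength_eq (t : ℕ) :
    averagePathLength t = (∑ u : Vertex t, ∑ v : Vertex t, ((network t).dist u v : ℝ)) /
      ((Fintype.card (Vertex t) : ℝ) * (Fintype.card (Vertex t) - 1)) := by
  classical
  have key : ∑ u : Vertex t, ∑ v : Vertex t, ((network t).dist u v : ℝ) =
      2 * ∑ e : Sym2 (Vertex t) with ¬ e.IsDiag, (pairDist t e : ℝ) := by
    rw [← Fintype.sum_prod_type' fun u v => ((network t).dist u v : ℝ),
      ← sum_subset (filter_subset (fun p : Vertex t × Vertex t => p.1 ≠ p.2) univ)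
        (fun p _ hp => by
          have hp' : p.1 = p.2 := by simpa using hp
          simp [hp']),
      ← sum_fiberwise_of_maps_to (t := {e : Sym2 (Vertex t) | ¬ e.IsDiag})
        (g := fun p : Vertex t × Vertex t => s(p.1, p.2))
        (fun p hp => by simpa using hp), mul_sum]
    refine sum_congr rfl fun e => ?_
    induction e with
    | h a b =>
      intro hab
      have hab' : a ≠ b := by simpa using hab
      -- Each unordered pair comes from exactly two ordered ones, whence the factor 2.
      have hfib : {p ∈ ({p | p.1 ≠ p.2} : Finset (Vertex t × Vertex t)) | s(p.1, p.2) = s(a, b)} =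
          {(a, b), (b, a)} := by
        ext ⟨u, v⟩
        simp only [mem_filter, mem_univ, true_and, mem_insert, mem_singleton, Sym2.eq_iff,
          Prod.mk.injEq]
        constructor
        · exact fun h => h.2
        · rintro (⟨rfl, rfl⟩ | ⟨rfl, rfl⟩)
          · exact ⟨hab', .inl ⟨rfl, rfl⟩⟩
          · exact ⟨hab'.symm, .inr ⟨rfl, rfl⟩⟩
      rw [hfib, sum_pair (by simp [hab']), dist_comm (u := b), two_mul]
      rfl
  rw [averagePathLength, key, div_div_eq_mul_div, mul_comm]

theorem sum_dist_le (t : ℕ) :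
    ∑ u : Vertex t, ∑ v : Vertex t, ((network t).dist u v : ℝ) ≤
      2 * Fintype.card (Vertex t) * ∑ v : Vertex t, (blocks univ v.1 : ℝ) := by
  have h : ∑ u : Vertex t, ∑ v : Vertex t, ((network t).dist u v : ℝ) ≤
      ∑ u : Vertex t, ∑ v : Vertex t, ((blocks univ u.1 : ℝ) + blocks univ v.1) :=
    sum_le_sum fun u _ => sum_le_sum fun v _ => mod_cast dist_le_blocks_add_blocks u v
  refine h.trans_eq ?_
  simp only [sum_add_distrib, sum_const, card_univ, nsmul_eq_mul, ← mul_sum]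
  ring

/-- The 6 is 2 from the mean common length, at most 1, plus the constant 2 · 2. -/
theorem le_sum_dist (t : ℕ) :
    2 * Fintype.card (Vertex t) * ∑ v : Vertex t, (blocks univ v.1 : ℝ) -
        6 * (Fintype.card (Vertex t) : ℝ) ^ 2 ≤
      ∑ u : Vertex t, ∑ v : Vertex t, ((network t).dist u v : ℝ) := by
  have h : ∑ u : Vertex t, ∑ v : Vertex t, ((blocks univ u.1 : ℝ) + blocks univ v.1) ≤
      ∑ u : Vertex t, ∑ v : Vertex t,
        (((network t).dist u v : ℝ) + 2 * ((commonLength u.1 v.1 : ℝ) + 2)) :=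
    sum_le_sum fun u _ => sum_le_sum fun v _ => mod_cast blocks_add_blocks_le_dist u v
  have hc : ∑ u : Vertex t, ∑ v : Vertex t, (commonLength u.1 v.1 : ℝ) ≤
      (Fintype.card (Vertex t) : ℝ) ^ 2 := mod_cast sum_commonLength_le t
  simp only [sum_add_distrib, sum_const, card_univ, nsmul_eq_mul, ← mul_sum] at h
  nlinarith

/-! ### Limits -/

theorem tendsto_pow_div_card :
    Tendsto (fun t : ℕ => (3 : ℝ) ^ t / (Fintype.card (Vertex t) - 1)) atTop (𝓝 (2 / 3)) := by
  have h0 : Tendsto (fun t : ℕ => ((1 : ℝ) / 3) ^ t) atTop (𝓝 0) :=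
    tendsto_pow_atTop_nhds_zero_of_lt_one (by norm_num) (by norm_num)
  have h1 : Tendsto (fun t : ℕ => (2 : ℝ) / (3 - 3 * (1 / 3) ^ t)) atTop (𝓝 (2 / (3 - 3 * 0))) :=
    tendsto_const_nhds.div (tendsto_const_nhds.sub (h0.const_mul 3)) (by norm_num)
  rw [show (2 : ℝ) / (3 - 3 * 0) = 2 / 3 by norm_num] at h1
  refine h1.congr fun t => ?_
  have h3 : (3 : ℝ) ^ t ≠ 0 := by positivity
  rw [card_vertex, one_div, inv_pow, show ((3 : ℝ) ^ (t + 1) - 1) / 2 - 1 =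
    3 ^ t * (3 - 3 * (3 ^ t)⁻¹) / 2 by field_simp; ring, div_div_eq_mul_div,
    mul_div_mul_left _ _ h3]

theorem tendsto_card_div_card :
    Tendsto (fun t : ℕ => (Fintype.card (Vertex t) : ℝ) / (Fintype.card (Vertex t) - 1))
      atTop (𝓝 1) := by
  have h0 : Tendsto (fun t : ℕ => ((1 : ℝ) / 3) ^ t) atTop (𝓝 0) :=
    tendsto_pow_atTop_nhds_zero_of_lt_one (by norm_num) (by norm_num)
  have h := tendsto_pow_div_card.mul ((h0.const_sub 3).div_const 2)
  rw [show (2 / 3 : ℝ) * ((3 - 0) / 2) = 1 by norm_num] at h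
  refine h.congr fun t => ?_
  have h3 : (3 : ℝ) ^ t ≠ 0 := by positivity
  rw [div_mul_eq_mul_div, one_div, inv_pow]
  congr 1
  rw [card_vertex]
  field_simp
  ring

theorem tendsto_averagePathLength_div :
    Tendsto (fun t : ℕ => averagePathLength t / (t : ℝ)) atTop (𝓝 (4 / 9)) := by
  have hinv : Tendsto (fun t : ℕ => (t : ℝ)⁻¹) atTop (𝓝 0) := tendsto_inv_atTop_nhds_zero_nat
  have hup : Tendsto (fun t : ℕ => 2 / 3 * (1 + 2 * (t : ℝ)⁻¹) *
      ((3 : ℝ) ^ t / (Fintype.card (Vertex t) - 1))) atTop (𝓝 (4 / 9)) := by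
    have h := (((hinv.const_mul 2).const_add 1).const_mul (2 / 3)).mul tendsto_pow_div_card
    rwa [show (2 / 3 : ℝ) * (1 + 2 * 0) * (2 / 3) = 4 / 9 by norm_num] at h
  -- The subtracted term is the error `6 * N ^ 2` divided by `N * (N - 1) * t`, where `N` is the
  -- number of vertices.
  have hlow : Tendsto (fun t : ℕ => 2 / 3 * (1 + 2 * (t : ℝ)⁻¹) *
      ((3 : ℝ) ^ t / (Fintype.card (Vertex t) - 1)) -
      6 * (t : ℝ)⁻¹ * ((Fintype.card (Vertex t) : ℝ) / (Fintype.card (Vertex t) - 1)))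
      atTop (𝓝 (4 / 9)) := by
    have h := hup.sub ((hinv.const_mul 6).mul tendsto_card_div_card)
    rwa [show (4 / 9 : ℝ) - 6 * 0 * 1 = 4 / 9 by norm_num] at h
  have hblocks : ∀ t : ℕ, 0 < t →
      ∑ v : Vertex t, (blocks univ v.1 : ℝ) = (t + 2) * 3 ^ t / 3 := by
    intro t ht
    obtain ⟨s, rfl⟩ := Nat.exists_eq_add_of_lt ht
    rw [zero_add, sum_blocks_univ]
    push_cast
    ring
  have hcard : ∀ t : ℕ, 0 < t → (1 : ℝ) < Fintype.card (Vertex t) := by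
    intro t ht
    rw [card_vertex]
    have : (3 : ℝ) ^ 2 ≤ 3 ^ (t + 1) := pow_le_pow_right₀ (by norm_num) (by omega)
    linarith
  refine tendsto_of_tendsto_of_tendsto_of_le_of_le' hlow hup ?_ ?_ <;>
    filter_upwards [eventually_gt_atTop 0] with t ht <;>
    have hN := hcard t ht <;>
    have ht' : (0 : ℝ) < t := Nat.cast_pos.2 ht <;>
    have hN1 : (0 : ℝ) < Fintype.card (Vertex t) - 1 := by linarith
  · have h := le_sum_dist t
    rw [hblocks t ht] at h
    rw [averagePathLength_eq, div_div, le_div_iff₀ (by positivity)]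
    refine le_trans (le_of_eq ?_) h
    field_simp
  · have h := sum_dist_le t
    rw [hblocks t ht] at h
    rw [averagePathLength_eq, div_div, div_le_iff₀ (by positivity)]
    refine h.trans (le_of_eq ?_)
    field_simp

/-- The vertex count lies between `3 ^ t` and `3 ^ (t + 1)`. -/
theorem tendsto_log_card_div :
    Tendsto (fun t : ℕ => Real.log (Fintype.card (Vertex t) : ℝ) / (t : ℝ)) atTop
      (𝓝 (Real.log 3)) := by
  have hup : Tendsto (fun t : ℕ => Real.log 3 * (1 + (t : ℝ)⁻¹)) atTop (𝓝 (Real.log 3)) := by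
    simpa using (tendsto_inv_atTop_nhds_zero_nat (𝕜 := ℝ)).const_add 1 |>.const_mul (Real.log 3)
  refine tendsto_of_tendsto_of_tendsto_of_le_of_le' tendsto_const_nhds hup ?_ ?_ <;>
    filter_upwards [eventually_gt_atTop 0] with t ht <;>
    have ht' : (0 : ℝ) < t := Nat.cast_pos.2 ht <;>
    have h3 : (1 : ℝ) ≤ 3 ^ t := one_le_pow₀ (by norm_num) <;>
    rw [card_vertex]
  · rw [le_div_iff₀ ht', mul_comm, ← Real.log_pow]
    exact Real.log_le_log (by positivity) (by rw [pow_succ]; linarith)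
  · rw [div_le_iff₀ ht']
    have h : Real.log 3 * (1 + (t : ℝ)⁻¹) * t = Real.log (3 ^ (t + 1)) := by
      rw [Real.log_pow]
      push_cast
      field_simp
    rw [h]
    exact Real.log_le_log (by rw [pow_succ]; linarith) (by rw [pow_succ]; linarith)

theorem tendsto_averagePathLength_div_log :
    Tendsto (fun t : ℕ => averagePathLength t / Real.log (Fintype.card (Vertex t) : ℝ))
      atTop (𝓝 (4 / (9 * Real.log 3))) := by
  have h := tendsto_averagePathLength_div.div tendsto_log_card_div
    (Real.log_pos (by norm_num)).ne'
  rw [div_div] at h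
  refine h.congr' ?_
  filter_upwards [eventually_gt_atTop 0] with t ht
  exact div_div_div_cancel_right₀ (Nat.cast_pos.2 ht).ne' _ _

end SierpinskiNetwork

theorem theorem1 :
    (∀ t : ℕ, (SierpinskiNetwork.network t).Connected) ∧
    Filter.Tendsto (fun t : ℕ => SierpinskiNetwork.averagePathLength t / (t : ℝ))
      Filter.atTop (nhds (4 / 9)) ∧
    Filter.Tendsto
      (fun t : ℕ => SierpinskiNetwork.averagePathLength t /
        Real.log (Fintype.card (SierpinskiNetwork.Vertex t) : ℝ))
      Filter.atTop (nhds (4 / (9 * Real.log 3))) :=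
  ⟨SierpinskiNetwork.network_connected, SierpinskiNetwork.tendsto_averagePathLength_div,
    SierpinskiNetwork.tendsto_averagePathLength_div_log⟩
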